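/- Let $K$ be a field, $\overline K$ an algebraic closure of $K$, and $v$ a (Krull) valuation on $\overline K(X)$, written additively. Write $vF$ and $Fv$ for the value group and the residue field of a subfield $F$ of $\overline K(X)$. Assume that $(K(X)|K,v)$ is valuation algebraic, that is, $\dim_{\mathbb Q}\big(\mathbb Q\otimes_{\mathbb Z}(vK(X)/vK)\big)+\operatorname{trdeg}[K(X)v:Kv]<1$. For $a\in\overline K$ and $\gamma\in v\overline K(X)$ let $v_{a,\gamma}\big(\sum_i c_i(X-a)^i\big)=\min_i\{v c_i+i\gamma\}$ $(c_i\in\overline K)$. A pair $(a,\gamma)$ is a minimal pair of definition for a valuation $w$ over $K$ if $w=v_{a,\gamma}$ and $[K(a'):K]\ge[K(a):K]$ for all $a'\in\overline K$ with $v(a-a')\ge\gamma$. Then there are a limit ordinal $\lambda$ and sequences $\{\gamma_\nu\}_{\nu<\lambda}\subseteq v(X-\overline K):=\{v(X-b)\mid b\in\overline K\}$ and $\{a_\nu\}_{\nu<\lambda}\subseteq\overline K$ such that 1. $\{\gamma_\nu\}_{\nu<\lambda}$ is strictly increasing and cofinal in $v(X-\overline K)$; 2. for all $\nu<\lambda$: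 $v(X-a_\nu)=\gamma_\nu$, the pair $(a_\nu,\gamma_\nu)$ is a minimal pair of definition for $v_{a_\nu,\gamma_\nu}$ over $K$, and $v(X-a_\nu)\ge v(X-\sigma a_\nu)$ for all $K$-conjugates $\sigma a_\nu$ of $a_\nu$. Take any such sequences and let $Q_\nu\in K[X]$ be the minimal polynomial of $a_\nu$ over $K$. For nonzero $f\in K[X]$ let $\delta(f)=\max\{v(X-a)\mid a\in\overline K,\ f(a)=0\}$, with $\delta(f)=-\infty$ if $f$ is constant. Then $\{Q_\nu\}_{\nu<\lambda}$ is a complete sequence of key polynomials for $v$ over $K$, that is: * every $Q_\nu$ is a key polynomial for $v$ over $K$: it is monic and nonconstant, and $\delta(f)<\delta(Q_\nu)$ for every nonzero $f\in K[X]$ with $\deg f<\deg Q_\nu$; * the values $\delta(Q_\nu)$, $\nu<\lambda$, are pairwise distinct, and $\{Q_\nu\}_{\nu<\lambda}$ is well-ordered by $Q<Q'\iff\delta(Q)<\delta(Q')$; * for every $f\in K[X]$ there is $\nu<\lambda$ with $vf=v_{Q_\nu}f$, where $v_Q f=\min_i\{v f_i+i\,vQ\}$ for the expansion $f=f_0+f_1Q+\dots+f_rQ^r$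 with $f_i\in K[X]$, $\deg f_i<\deg Q$. -/

import Mathlib

open Polynomial
open scoped TensorProduct IntermediateField

universe u₁ u₂ u₃ u₄

namespace KeyPol

section ValuedExtensions

variable {F Γ : Type*} [Field F] [AddCommGroup Γ] [LinearOrder Γ] [IsOrderedAddMonoid Γ]

/-- The value group `vF = {v x | x ∈ F, x ≠ 0}` of a valued field `(F, v)`, where `v` is a Krull
valuation written additively, with values in `Γ ∪ {∞}`. -/
def valueGroup (v : AddValuation F (WithTop Γ)) : AddSubgroup Γ where
  carrier := {γ | ∃ x : F, v x = (γ : WithTop Γ)}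
  zero_mem' := ⟨1, by simp⟩
  add_mem' := by
    rintro a b ⟨x, hx⟩ ⟨y, hy⟩
    exact ⟨x * y, by rw [v.map_mul, hx, hy, WithTop.coe_add]⟩
  neg_mem' := by
    rintro a ⟨x, hx⟩
    exact ⟨x⁻¹, by rw [AddValuation.map_inv, hx, ← WithTop.LinearOrderedAddCommGroup.coe_neg]⟩

/-- The valuation ring `{x | v x ≥ 0}` of `(F, v)`. -/
abbrev valRing (v : AddValuation F (WithTop Γ)) : ValuationSubring F :=
  (AddValuation.toValuation v).valuationSubring

theorem mem_valRing (v : AddValuation F (WithTop Γ)) (x : F) : x ∈ valRing v ↔ 0 ≤ v x :=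
  Iff.rfl

/-- The residue field `Fv` of `(F, v)`. -/
abbrev ResField (v : AddValuation F (WithTop Γ)) : Type _ :=
  IsLocalRing.ResidueField (valRing v)

variable (K : Type*) [Field K] [Algebra K F]

/-- The restriction of `v` from `F` to `K`. -/
abbrev restr (v : AddValuation F (WithTop Γ)) : AddValuation K (WithTop Γ) :=
  v.comap (algebraMap K F)

instance instHasExtension (v : AddValuation F (WithTop Γ)) :
    (AddValuation.toValuation (restr K v)).HasExtension (AddValuation.toValuation v) :=
  ⟨Valuation.IsEquiv.refl⟩

/-- The rational rank of `vF / vK`, i.e. the `ℚ`-dimension of `ℚ ⊗ (vF / vK)`. -/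
noncomputable def ratRank (v : AddValuation F (WithTop Γ)) : Cardinal :=
  Module.rank ℚ
    (ℚ ⊗[ℤ] (valueGroup v ⧸ (valueGroup (restr K v)).addSubgroupOf (valueGroup v)))

/-- The transcendence degree of the residue field extension `Fv | Kv`. -/
noncomputable def resTrdeg (v : AddValuation F (WithTop Γ)) : Cardinal :=
  Algebra.trdeg (ResField (restr K v)) (ResField v)

end ValuedExtensions

section RationalFunctionField

variable {K : Type*} {L : Type*} {Γ : Type*} [Field K] [Field L] [Algebra K L]
  [AddCommGroup Γ] [LinearOrder Γ] [IsOrderedAddMonoid Γ]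

/-- The subfield `K(X)` of `L(X)`. -/
noncomputable abbrev ratSubfield (K L : Type*) [Field K] [Field L] [Algebra K L] :
    IntermediateField K (RatFunc L) :=
  IntermediateField.adjoin K {(RatFunc.X : RatFunc L)}

/-- For a valuation `v` of `L(X)`, the extension `(K(X) | K, v)` is valuation algebraic: the
Abhyankar inequality `rr vK(X)/vK + trdeg [K(X)v : Kv] ≤ 1` is strict. -/
def IsValuationAlgebraic (K : Type u₁) {L : Type u₂} {Γ : Type u₃} [Field K] [Field L] [Algebra K L]
    [AddCommGroup Γ] [LinearOrder Γ] [IsOrderedAddMonoid Γ]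
    (v : AddValuation (RatFunc L) (WithTop Γ)) : Prop :=
  Cardinal.lift.{u₂, u₃} (ratRank K (restr (ratSubfield K L) v)) +
    Cardinal.lift.{u₃, u₂} (resTrdeg K (restr (ratSubfield K L) v)) < 1

/-- The value `v f` of a polynomial `f` over `L`. -/
noncomputable def valPoly (v : AddValuation (RatFunc L) (WithTop Γ)) (f : L[X]) : WithTop Γ :=
  v (algebraMap L[X] (RatFunc L) f)

/-- The value `v a` of a constant `a` in `L`. -/
noncomputable def valConst (v : AddValuation (RatFunc L) (WithTop Γ)) (a : L) : WithTop Γ :=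
  valPoly v (C a)

/-- The map `v_{a,γ}` on `L[X]`: if `f = ∑ cᵢ (X - a)ⁱ` then `v_{a,γ} f = min (v cᵢ + i γ)`.
The `cᵢ` are the coefficients of the Taylor expansion of `f` at `a`; the missing ones are zero
and have value `∞`. -/
noncomputable def valPair (v : AddValuation (RatFunc L) (WithTop Γ)) (a : L) (γ : Γ) (f : L[X]) :
    WithTop Γ :=
  (Finset.range (f.natDegree + 1)).inf
    fun i => valConst v ((taylor a f).coeff i) + ((i • γ : Γ) : WithTop Γ)

/-- `(a, γ)` is a pair of definition for `w`, that is, `w = v_{a,γ}`. Here `w` is an extension to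
`L(X)` of the restriction of `v` to `L`, given by its values on `L[X]`. -/
def IsPairOfDefinition (v : AddValuation (RatFunc L) (WithTop Γ)) (w : L[X] → WithTop Γ)
    (a : L) (γ : Γ) : Prop :=
  ∀ f : L[X], w f = valPair v a γ f

/-- `(a, γ)` is a minimal pair of definition for `w` over `K`. -/
structure IsMinimalPair (K : Type*) {L Γ : Type*} [Field K] [Field L] [Algebra K L]
    [AddCommGroup Γ] [LinearOrder Γ] [IsOrderedAddMonoid Γ]
    (v : AddValuation (RatFunc L) (WithTop Γ)) (w : L[X] → WithTop Γ) (a : L) (γ : Γ) : Prop where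
  pair : IsPairOfDefinition v w a γ
  minimal : ∀ a' : L, (γ : WithTop Γ) ≤ valConst v (a - a') →
    Module.finrank K K⟮a⟯ ≤ Module.finrank K K⟮a'⟯

/-- The data `(a_ν, γ_ν)`, `ν < lam`, attached to `(K(X) | K, v)`, where `lam` is a limit ordinal
and `L` is an algebraic closure of `K`. -/
structure IsApproxSequence (K : Type*) {L Γ : Type*} [Field K] [Field L] [Algebra K L]
    [AddCommGroup Γ] [LinearOrder Γ] [IsOrderedAddMonoid Γ]
    (v : AddValuation (RatFunc L) (WithTop Γ)) (lam : Ordinal)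
    (γ : Set.Iio lam → Γ) (a : Set.Iio lam → L) : Prop where
  isLimit : Order.IsSuccLimit lam
  strictMono : StrictMono γ
  /-- the `γ_ν` are cofinal in `v(X - L) = {v (X - b) | b ∈ L}` -/
  cofinal : ∀ b : L, ∃ ν, valPoly v (X - C b) ≤ (γ ν : WithTop Γ)
  val_eq : ∀ ν, valPoly v (X - C (a ν)) = (γ ν : WithTop Γ)
  minimalPair : ∀ ν, IsMinimalPair K v (valPair v (a ν) (γ ν)) (a ν) (γ ν)
  conj_le : ∀ ν, ∀ σ : L ≃ₐ[K] L, valPoly v (X - C (σ (a ν))) ≤ valPoly v (X - C (a ν))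

/-- The value `v f` of a polynomial `f` over `K`. -/
noncomputable def val (v : AddValuation (RatFunc L) (WithTop Γ)) (f : K[X]) : WithTop Γ :=
  valPoly v (f.map (algebraMap K L))

/-- `δ(f) = max {v (X - a) | a ∈ L, f(a) = 0}` for `f ≠ 0`. A nonzero constant polynomial has no
roots and its `δ` is `-∞`, the bottom element. (The value at `f = 0` has no meaning.) -/
noncomputable def delta (v : AddValuation (RatFunc L) (WithTop Γ)) (f : K[X]) :
    WithBot (WithTop Γ) :=
  ((f.aroots L).map fun a => ((valPoly v (X - C a) : WithTop Γ) : WithBot (WithTop Γ))).sup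

/-- `Q` is an (abstract) key polynomial for `v` over `K`. -/
structure IsKeyPolynomial (v : AddValuation (RatFunc L) (WithTop Γ)) (Q : K[X]) : Prop where
  monic : Q.Monic
  natDegree_pos : 0 < Q.natDegree
  delta_lt : ∀ f : K[X], f ≠ 0 → f.degree < Q.degree → delta v f < delta v Q

/-- The `i`-th coefficient `fᵢ` in the `Q`-expansion `f = f₀ + f₁ Q + ⋯ + f_r Q ^ r`,
`deg fᵢ < deg Q`. -/
noncomputable def expCoeff (Q f : K[X]) (i : ℕ) : K[X] :=
  (f /ₘ Q ^ i) %ₘ Q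

theorem degree_expCoeff_lt {Q : K[X]} (hQ : Q.Monic) (f : K[X]) (i : ℕ) :
    (expCoeff Q f i).degree < Q.degree :=
  degree_modByMonic_lt _ hQ

theorem sum_expCoeff {Q : K[X]} (hQ : Q.Monic) (hd : 0 < Q.natDegree) (f : K[X]) :
    f = ∑ i ∈ Finset.range (f.natDegree + 1), expCoeff Q f i * Q ^ i := by
  have key : ∀ n : ℕ,
      f = ∑ i ∈ Finset.range n, expCoeff Q f i * Q ^ i + (f /ₘ Q ^ n) * Q ^ n := by
    intro n
    induction n with
    | zero => simp
    | succ n ih =>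
      have h1 : f /ₘ Q ^ (n + 1) = (f /ₘ Q ^ n) /ₘ Q := by
        refine (div_modByMonic_unique _ ((f /ₘ Q ^ n) %ₘ Q * Q ^ n + f %ₘ Q ^ n)
          (hQ.pow (n + 1)) ⟨?_, ?_⟩).1
        · have e1 := modByMonic_add_div f (Q ^ n)
          have e2 := modByMonic_add_div (f /ₘ Q ^ n) Q
          linear_combination e1 + Q ^ n * e2
        · have hQn := (hQ.pow n).ne_zero
          have hlt : (Q ^ n).degree < (Q ^ (n + 1)).degree := by
            rw [degree_eq_natDegree hQn, degree_eq_natDegree (hQ.pow (n + 1)).ne_zero,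
              hQ.natDegree_pow, hQ.natDegree_pow]
            exact_mod_cast Nat.mul_lt_mul_of_pos_right (Nat.lt_succ_self n) hd
          refine (degree_add_le _ _).trans_lt (max_lt ?_ ?_)
          · by_cases h0 : (f /ₘ Q ^ n) %ₘ Q = 0
            · rw [h0, zero_mul, degree_zero]
              rw [bot_lt_iff_ne_bot, Ne, degree_eq_bot]
              exact (hQ.pow (n + 1)).ne_zero
            · have hr := degree_modByMonic_lt (f /ₘ Q ^ n) hQ
              rw [pow_succ', degree_mul, degree_mul, degree_eq_natDegree h0,
                degree_eq_natDegree hQ.ne_zero, degree_eq_natDegree hQn]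
              rw [degree_eq_natDegree h0, degree_eq_natDegree hQ.ne_zero] at hr
              norm_cast at hr ⊢
              omega
          · exact (degree_modByMonic_lt _ (hQ.pow n)).trans hlt
      have e2 := modByMonic_add_div (f /ₘ Q ^ n) Q
      rw [Finset.sum_range_succ, h1]
      unfold expCoeff at ih ⊢
      linear_combination ih - Q ^ n * e2
  have h := key (f.natDegree + 1)
  have h0 : f /ₘ Q ^ (f.natDegree + 1) = 0 := by
    rw [divByMonic_eq_zero_iff (hQ.pow _)]
    refine degree_le_natDegree.trans_lt ?_
    rw [degree_eq_natDegree (hQ.pow _).ne_zero, hQ.natDegree_pow]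
    have : f.natDegree + 1 ≤ (f.natDegree + 1) * Q.natDegree := Nat.le_mul_of_pos_right _ hd
    exact_mod_cast this
  rw [h0, zero_mul, add_zero] at h
  exact h

/-- The truncation `v_Q f = min (v fᵢ + i v Q)`, where `f = f₀ + f₁ Q + ⋯ + f_r Q ^ r` is the
`Q`-expansion of `f`, for `Q` monic and nonconstant. The terms with `fᵢ = 0` are `∞`. -/
noncomputable def truncVal (v : AddValuation (RatFunc L) (WithTop Γ)) (Q f : K[X]) : WithTop Γ :=
  (Finset.range (f.natDegree + 1)).inf fun i => val v (expCoeff Q f i) + i • val v Q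

/-- The set `Λ` is a complete sequence of key polynomials for `v` over `K`. -/
structure IsCompleteSequence (v : AddValuation (RatFunc L) (WithTop Γ)) (Λ : Set K[X]) : Prop where
  isKey : ∀ Q ∈ Λ, IsKeyPolynomial v Q
  delta_ne : ∀ Q ∈ Λ, ∀ Q' ∈ Λ, Q ≠ Q' → delta v Q ≠ delta v Q'
  wellOrdered : IsWellOrder Λ (fun Q Q' => delta v (Q : K[X]) < delta v (Q' : K[X]))
  complete : ∀ f : K[X], ∃ Q ∈ Λ, val v f = truncVal v Q f

end RationalFunctionField

end KeyPol

/-! Existence rests on `v(X - L)` having no maximum. Given `b`, the value of `X - b` is torsion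
modulo `vK`, so some `e` in `L` has the same value; the residue of `(X - b)/e` is algebraic over
`Kv`, hence is approximated by some `x` in `L`, and `b + e x` lies closer to `X`. Above each bound,
an element of least degree, replaced by its conjugate nearest to `X`, gives a minimal pair; a
well-ordered cofinal set of the resulting values is enumerated.

For the key polynomials, a root at least as close to `X` as `a_ν` lies within `γ_ν` of `a_ν`, so
minimality bounds its degree below by `deg Q_ν`. Since `a_ν` is nearest among its conjugates,
`δ(Q_ν) = γ_ν`.

For completeness, choose `ν` with no root of `f` closer to `X` than `a_ν`. Then `vf ≤ v_{a,γ} f`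
(`val_le_valPair`), and peeling off remainders modulo `Q_ν` gives `v_{a,γ} f ≤ v f_i + i vQ_ν` for
all `i` (`valPair_le_divByMonic_pow`, `valPair_le_val_modByMonic`). The other inequality is
ultrametric. That `v_{a,γ}` is a valuation is never needed, only two one-sided product estimates. -/

namespace KeyPol

/-! ### Values and residues of algebraic elements -/

section AlgebraicElements

variable {F E Γ : Type*} [Field F] [Field E] [Algebra F E]
  [AddCommGroup Γ] [LinearOrder Γ] [IsOrderedAddMonoid Γ]

theorem exists_coe_eq (w : AddValuation E (WithTop Γ)) {y : E} (hy : y ≠ 0) :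
    ∃ g : Γ, w y = g := by
  obtain ⟨g, hg⟩ := WithTop.ne_top_iff_exists.1 (w.ne_top_iff.2 hy)
  exact ⟨g, hg.symm⟩

/-- The value of an algebraic element is torsion modulo the value group of the base field. -/
theorem exists_nsmul_eq_of_isAlgebraic (w : AddValuation E (WithTop Γ)) {y : E} (hy : y ≠ 0)
    (h : IsAlgebraic F y) :
    ∃ n : ℕ, 0 < n ∧ ∃ c : F, c ≠ 0 ∧ n • w y = w (algebraMap F E c) := by
  obtain ⟨p, hp, hpy⟩ := h
  have hne : ∀ i ∈ p.support, algebraMap F E (p.coeff i) * y ^ i ≠ 0 := fun i hi =>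
    mul_ne_zero (by simpa using mem_support_iff.1 hi) (pow_ne_zero _ hy)
  obtain ⟨i, hi, hmin⟩ := p.support.exists_min_image
    (fun i => w (algebraMap F E (p.coeff i) * y ^ i)) (nonempty_support_iff.2 hp)
  -- The terms of `p(y) = 0` cannot have a unique term of least value. Two terms of equal value
  -- determine a multiple of `w y`.
  obtain ⟨j, hj, hij, hle⟩ : ∃ j ∈ p.support, j ≠ i ∧
      w (algebraMap F E (p.coeff j) * y ^ j) ≤ w (algebraMap F E (p.coeff i) * y ^ i) := by
    by_contra! hcon
    have hsum : ∑ j ∈ p.support, algebraMap F E (p.coeff j) * y ^ j = 0 := by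
      rw [← hpy, aeval_eq_sum_range' (Nat.lt_succ_self _)]
      simp only [← Algebra.smul_def]
      refine Finset.sum_subset (fun k hk => ?_) (fun k _ hk => ?_)
      · exact Finset.mem_range.2 (Nat.lt_succ_of_le (le_natDegree_of_mem_supp k hk))
      · simp [notMem_support_iff.1 hk]
    rw [← Finset.add_sum_erase _ _ hi] at hsum
    have hlt := w.map_lt_sum (w.ne_top_iff.2 (hne i hi)) (s := p.support.erase i)
      (f := fun j => algebraMap F E (p.coeff j) * y ^ j)
      fun j hj => hcon j (Finset.mem_of_mem_erase hj) (Finset.ne_of_mem_erase hj)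
    rw [eq_neg_of_add_eq_zero_left hsum, w.map_neg] at hlt
    exact lt_irrefl _ hlt
  have heq := le_antisymm hle (hmin j hj)
  clear hle
  wlog hlt : i < j generalizing i j
  · exact this j hj (fun k hk => heq ▸ hmin k hk) i hi hij.symm heq.symm
      (lt_of_le_of_ne (not_lt.1 hlt) hij)
  have hi0 := mem_support_iff.1 hi
  have hj0 := mem_support_iff.1 hj
  refine ⟨j - i, Nat.sub_pos_of_lt hlt, p.coeff i / p.coeff j, div_ne_zero hi0 hj0, ?_⟩
  have hj0' : algebraMap F E (p.coeff j) ≠ 0 := by simpa using hj0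
  obtain ⟨s, hs⟩ := exists_coe_eq w (y := algebraMap F E (p.coeff i)) (by simpa using hi0)
  obtain ⟨t, ht⟩ := exists_coe_eq w hj0'
  obtain ⟨r, hr⟩ := exists_coe_eq w (y := algebraMap F E (p.coeff i / p.coeff j))
    (by simpa using ⟨hi0, hj0⟩)
  obtain ⟨g, hg⟩ := exists_coe_eq w hy
  have h1 : r + t = s := by
    rw [← WithTop.coe_inj, WithTop.coe_add, ← hs, ← ht, ← hr, ← w.map_mul, ← map_mul,
      div_mul_cancel₀ _ hj0]
  rw [w.map_mul, w.map_mul, w.map_pow, w.map_pow, hs, ht, hg] at heq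
  have h2 : t + j • g = s + i • g := by exact_mod_cast heq
  rw [hg, hr, ← WithTop.coe_nsmul, WithTop.coe_inj]
  have h3 : j • g = (j - i) • g + i • g := by rw [← add_nsmul, Nat.sub_add_cancel hlt.le]
  rw [h3, ← h1] at h2
  have h4 : t + (j - i) • g = t + r := by
    apply add_right_cancel (b := i • g)
    rw [add_assoc, h2, add_comm r t]
  exact add_left_cancel h4

/-- The residue of an algebraic element is algebraic over the residue field of the base field. -/
theorem isAlgebraic_residue (w : AddValuation E (WithTop Γ)) (y : valRing w)
    (h : IsAlgebraic F (y : E)) :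
    IsAlgebraic (ResField (restr F w)) (IsLocalRing.residue (valRing w) y) := by
  obtain ⟨p, hp, hpy⟩ := h
  obtain ⟨i, hi, hmin⟩ := p.support.exists_min_image (fun i => restr F w (p.coeff i))
    (nonempty_support_iff.2 hp)
  have hi0 : p.coeff i ≠ 0 := mem_support_iff.1 hi
  -- Dividing by a coefficient of least value makes `p` integral with `i`-th coefficient `1`, so its
  -- reduction is nonzero.
  have hint : ∀ j, ((C (p.coeff i)⁻¹ * p).coeff j) ∈ valRing (restr F w) := by
    intro j
    rw [mem_valRing, coeff_C_mul, AddValuation.map_mul]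
    by_cases hj : p.coeff j = 0
    · simp [hj]
    calc (0 : WithTop Γ) = restr F w ((p.coeff i)⁻¹ * p.coeff i) := by simp [hi0]
      _ = restr F w (p.coeff i)⁻¹ + restr F w (p.coeff i) := AddValuation.map_mul _ _ _
      _ ≤ _ := by gcongr; exact hmin j (mem_support_iff.2 hj)
  have hlift : C (p.coeff i)⁻¹ * p ∈ lifts (algebraMap (valRing (restr F w)) F) := by
    rw [lifts_iff_coeff_lifts]
    exact fun j => ⟨⟨_, hint j⟩, rfl⟩
  obtain ⟨q, hq⟩ := hlift
  rw [coe_mapRingHom] at hq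
  refine ⟨q.map (algebraMap _ _), ?_, ?_⟩
  · intro h0
    have h1 := congrArg (fun r => coeff r i) h0
    simp only [coeff_map, coeff_zero] at h1
    have h2 : q.coeff i = 1 := by
      apply Subtype.ext
      have := congrArg (fun r => coeff r i) hq
      simpa [hi0] using this
    simp [h2] at h1
  · have h1 : aeval y q = 0 := by
      apply Subtype.ext
      have h2 : aeval (y : E) q = 0 := by
        rw [← aeval_map_algebraMap F, hq, map_mul, hpy, mul_zero]
      exact (aeval_algebraMap_apply E y q).symm.trans h2
    rw [aeval_map_algebraMap]
    have h3 := aeval_algebraMap_apply (ResField w) y q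
    rw [h1, map_zero] at h3
    exact h3

theorem exists_pos_of_prod_pos (w : AddValuation E (WithTop Γ)) {s : Multiset E}
    (hs : 0 < w s.prod) : ∃ x ∈ s, 0 < w x := by
  induction s using Multiset.induction with
  | empty => simp at hs
  | cons a s ih =>
    by_cases ha : 0 < w a
    · exact ⟨a, Multiset.mem_cons_self a s, ha⟩
    · rw [Multiset.prod_cons, w.map_mul] at hs
      obtain ⟨x, hx, h⟩ := ih (hs.trans_le (add_le_of_nonpos_left (not_lt.1 ha)))
      exact ⟨x, Multiset.mem_cons_of_mem hx, h⟩

end AlgebraicElements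

section Residues

variable {K L E Γ : Type*} [Field K] [Field L] [Field E] [Algebra K L] [Algebra L E] [Algebra K E]
  [IsScalarTower K L E] [AddCommGroup Γ] [LinearOrder Γ] [IsOrderedAddMonoid Γ]

/-- An element whose residue is algebraic over that of `K` is approximated by an element of `L`,
if `L` contains an algebraic closure of `K`. -/
theorem exists_pos_sub_of_isAlgebraic_residue [IsAlgClosed L] (w : AddValuation E (WithTop Γ))
    (y : valRing w)
    (h : IsAlgebraic (ResField (restr K w)) (IsLocalRing.residue (valRing w) y)) :
    ∃ e : L, 0 < w (y - algebraMap L E e) := by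
  have hmonic := minpoly.monic h.isIntegral
  obtain ⟨g, hg, -, hgm⟩ := lifts_and_natDegree_eq_and_monic
    (f := algebraMap (valRing (restr K w)) (ResField (restr K w)))
    (p := minpoly _ (IsLocalRing.residue (valRing w) y))
    (by rw [lifts_iff_coeff_lifts]
        exact fun n => IsLocalRing.residue_surjective _) hmonic
  have h0 : IsLocalRing.residue (valRing w) (aeval y g) = 0 := by
    have h1 := aeval_algebraMap_apply (ResField w) y g
    rw [← aeval_map_algebraMap (ResField (restr K w)), hg] at h1
    exact h1.symm.trans (minpoly.aeval _ _)
  rw [IsLocalRing.residue_eq_zero_iff, Valuation.mem_maximalIdeal_iff] at h0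
  have hpos : 0 < w (aeval y g : valRing w) := h0
  set G : L[X] := g.map ((algebraMap K L).comp (algebraMap (valRing (restr K w)) K)) with hG
  have hGm : G.Monic := hgm.map _
  have heval : ((aeval y g : valRing w) : E) = aeval (y : E) G := by
    have h1 := aeval_algebraMap_apply E y g
    refine h1.symm.trans ?_
    rw [hG, aeval_def, aeval_def, eval₂_map]
    congr 1
    ext x
    exact IsScalarTower.algebraMap_apply K L E x
  -- The lifted minimal polynomial has positive value at `y`. It splits over `L`, so one linear
  -- factor has positive value.
  rw [heval, (IsAlgClosed.splits G).eq_prod_roots_of_monic hGm, map_multiset_prod,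
    Multiset.map_map] at hpos
  obtain ⟨x, hx, hxpos⟩ := exists_pos_of_prod_pos w hpos
  obtain ⟨e, -, rfl⟩ := Multiset.mem_map.1 hx
  exact ⟨e, by simpa using hxpos⟩

end Residues

/-! ### Valuation algebraic extensions: no best approximation of `X` -/

section NoMaximum

/-- Tensoring with `ℚ` preserves the rank, and an abelian group of rank zero is torsion. -/
theorem exists_nsmul_eq_of_ratRank_eq_zero {K F Γ : Type*} [Field K] [Field F] [Algebra K F]
    [AddCommGroup Γ] [LinearOrder Γ] [IsOrderedAddMonoid Γ] (w : AddValuation F (WithTop Γ))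
    (h : ratRank K w = 0) {y : F} (hy : y ≠ 0) :
    ∃ n : ℕ, 0 < n ∧ ∃ c : K, c ≠ 0 ∧ n • w y = w (algebraMap K F c) := by
  set Q := valueGroup w ⧸ (valueGroup (restr K w)).addSubgroupOf (valueGroup w)
  have hbc := (TensorProduct.isBaseChange ℤ Q ℚ).lift_rank_eq
  rw [show Module.rank ℚ (ℚ ⊗[ℤ] Q) = 0 from h, Cardinal.lift_zero, eq_comm,
    Cardinal.lift_eq_zero, rank_eq_zero_iff] at hbc
  obtain ⟨g, hg⟩ := exists_coe_eq w hy
  obtain ⟨n, hn, hz⟩ := hbc (QuotientAddGroup.mk ⟨g, y, hg⟩)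
  have hz' : n.natAbs • (QuotientAddGroup.mk (⟨g, y, hg⟩ : valueGroup w) : Q) = 0 := by
    rw [← natCast_zsmul]
    rcases Int.natAbs_eq n with h1 | h1
    · rw [← h1, hz]
    · rw [← neg_eq_zero, ← neg_zsmul, ← h1, hz]
  rw [← QuotientAddGroup.mk_nsmul, QuotientAddGroup.eq_zero_iff,
    AddSubgroup.mem_addSubgroupOf] at hz'
  obtain ⟨c, hc⟩ := hz'
  have hc' : n.natAbs • w y = w (algebraMap K F c) := by
    rw [hg]
    exact (WithTop.coe_nsmul g _).symm.trans hc.symm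
  refine ⟨n.natAbs, Int.natAbs_pos.2 hn, c, ?_, hc'⟩
  rintro rfl
  rw [map_zero, w.map_zero, hg, ← WithTop.coe_nsmul] at hc'
  exact WithTop.coe_ne_top hc'

variable {K : Type u₁} {L : Type u₂} {Γ : Type u₃} [Field K] [Field L] [Algebra K L]
  [AddCommGroup Γ] [LinearOrder Γ] [IsOrderedAddMonoid Γ]

theorem IsValuationAlgebraic.ratRank_eq_zero {v : AddValuation (RatFunc L) (WithTop Γ)}
    (hv : IsValuationAlgebraic K v) : ratRank K (restr (ratSubfield K L) v) = 0 := by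
  have h := Cardinal.lt_one_iff.1 hv
  simpa using (add_eq_zero.1 h).1

theorem IsValuationAlgebraic.isAlgebraic_resField {v : AddValuation (RatFunc L) (WithTop Γ)}
    (hv : IsValuationAlgebraic K v) :
    Algebra.IsAlgebraic (ResField (restr K (restr (ratSubfield K L) v)))
      (ResField (restr (ratSubfield K L) v)) := by
  have h := Cardinal.lt_one_iff.1 hv
  have h2 := (add_eq_zero.1 h).2
  rw [Cardinal.lift_eq_zero] at h2
  exact trdeg_eq_zero_iff.1 h2

theorem isAlgebraic_ratSubfield_C [Algebra.IsAlgebraic K L] (b : L) :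
    IsAlgebraic (ratSubfield K L) (algebraMap L (RatFunc L) b) :=
  ((Algebra.IsAlgebraic.isAlgebraic (R := K) b).algebraMap).tower_top _

theorem isAlgebraic_ratSubfield_X_sub_C [Algebra.IsAlgebraic K L] (b : L) :
    IsAlgebraic (ratSubfield K L) (algebraMap L[X] (RatFunc L) (X - C b)) := by
  have h1 : IsAlgebraic (ratSubfield K L) (RatFunc.X : RatFunc L) :=
    isAlgebraic_algebraMap (⟨RatFunc.X, IntermediateField.mem_adjoin_simple_self K _⟩ :
      ratSubfield K L)
  have h2 := h1.sub (isAlgebraic_ratSubfield_C (K := K) b)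
  rw [map_sub, RatFunc.algebraMap_X]
  exact h2

/-- If `(K(X) | K, v)` is valuation algebraic, then `v(X - L)` has no maximum. -/
theorem IsValuationAlgebraic.exists_lt [IsAlgClosure K L]
    {v : AddValuation (RatFunc L) (WithTop Γ)} (hv : IsValuationAlgebraic K v) (b : L) :
    ∃ b' : L, valPoly v (X - C b) < valPoly v (X - C b') := by
  have : Algebra.IsAlgebraic K L := IsAlgClosure.isAlgebraic
  have : IsAlgClosed L := IsAlgClosure.isAlgClosed K
  set y : RatFunc L := algebraMap L[X] (RatFunc L) (X - C b) with hy
  have hy0 : y ≠ 0 := by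
    rw [hy, Ne, map_eq_zero_iff _ (IsFractionRing.injective _ _)]
    exact X_sub_C_ne_zero b
  have hyalg : IsAlgebraic (ratSubfield K L) y := isAlgebraic_ratSubfield_X_sub_C b
  obtain ⟨n, hn, c, hc, hnc⟩ := exists_nsmul_eq_of_isAlgebraic v hy0 hyalg
  obtain ⟨m, hm, d, hd, hmd⟩ := exists_nsmul_eq_of_ratRank_eq_zero _ hv.ratRank_eq_zero hc
  -- Here `m n v(y) = v(d)`, so an `mn`-th root of `d` has the value of `y`, the value group being
  -- torsion free.
  obtain ⟨e, he⟩ := IsAlgClosed.exists_pow_nat_eq (algebraMap K L d) (Nat.mul_pos hm hn)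
  have he0 : e ≠ 0 := by
    rintro rfl
    rw [zero_pow (Nat.mul_pos hm hn).ne', eq_comm, map_eq_zero] at he
    exact hd he
  set E := algebraMap L (RatFunc L) e with hE
  have hE0 : E ≠ 0 := by simpa [hE] using he0
  have hvE : v E = v y := by
    have h1 : (m * n) • v E = (m * n) • v y := by
      rw [mul_comm m n, mul_nsmul, mul_nsmul, hnc, ← mul_nsmul, mul_comm n m, ← v.map_pow, hE,
        ← map_pow, he]
      refine Eq.trans ?_ hmd.symm
      change _ = v _
      rw [← IsScalarTower.algebraMap_apply, ← IsScalarTower.algebraMap_apply]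
    obtain ⟨s, hs⟩ := exists_coe_eq v hE0
    obtain ⟨t, ht⟩ := exists_coe_eq v hy0
    rw [hs, ht, ← WithTop.coe_nsmul, ← WithTop.coe_nsmul, WithTop.coe_inj] at h1
    rw [hs, ht, nsmul_right_injective (Nat.mul_pos hm hn).ne' h1]
  have hz0 : v (y / E) = 0 := by
    have h1 : v (y / E) + v E = v E := by rw [← v.map_mul, div_mul_cancel₀ _ hE0, hvE]
    obtain ⟨s, hs⟩ := exists_coe_eq v hE0
    obtain ⟨t, ht⟩ := exists_coe_eq v (div_ne_zero hy0 hE0)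
    rw [hs, ht] at h1
    have h2 : t + s = s := by exact_mod_cast h1
    rw [ht, add_eq_right.1 h2, WithTop.coe_zero]
  have hzalg : IsAlgebraic (ratSubfield K L) (y / E) := by
    rw [div_eq_mul_inv]
    exact hyalg.mul (isAlgebraic_ratSubfield_C e).inv
  set z : valRing v := ⟨y / E, (mem_valRing v _).2 hz0.ge⟩
  -- Algebraicity descends through the residue field of `K(X)`, which is algebraic over `Kv` by
  -- hypothesis.
  have hzres : IsAlgebraic (ResField (restr K v)) (IsLocalRing.residue (valRing v) z) := by
    have := hv.isAlgebraic_resField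
    have h1 := isAlgebraic_residue (F := ratSubfield K L) v z hzalg
    have hr : restr K (restr (ratSubfield K L) v) = restr K v := rfl
    have : (AddValuation.toValuation (restr K v)).HasExtension
      (AddValuation.toValuation (restr (ratSubfield K L) v)) := ⟨Valuation.IsEquiv.refl⟩
    have : IsScalarTower (ResField (restr K v)) (ResField (restr (ratSubfield K L) v))
        (ResField v) := by
      refine IsScalarTower.of_algebraMap_eq fun x => ?_
      obtain ⟨x, rfl⟩ := IsLocalRing.residue_surjective x
      rfl
    have : Algebra.IsAlgebraic (ResField (restr K v)) (ResField (restr (ratSubfield K L) v)) :=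
      hv.isAlgebraic_resField
    exact h1.restrictScalars _
  obtain ⟨x, hx⟩ := exists_pos_sub_of_isAlgebraic_residue (L := L) v z hzres
  refine ⟨b + e * x, ?_⟩
  have hkey : algebraMap L[X] (RatFunc L) (X - C (b + e * x)) =
      E * (y / E - algebraMap L (RatFunc L) x) := by
    rw [mul_sub, mul_div_cancel₀ _ hE0, hy, C_add, ← sub_sub, map_sub _ (X - C b), hE, ← map_mul]
    rfl
  change v _ < v _
  rw [hkey, v.map_mul, hvE]
  obtain ⟨t, ht⟩ := exists_coe_eq v hy0
  rw [ht]
  simpa using WithTop.add_lt_add_left (WithTop.coe_ne_top (a := t)) hx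

end NoMaximum

/-- A set without maximum in a linear order has a cofinal strictly increasing enumeration by a
limit ordinal. -/
theorem exists_strictMono_cofinal {Γ : Type u₃} [LinearOrder Γ] {S : Set Γ} (hS : S.Nonempty)
    (hmax : ∀ x ∈ S, ∃ y ∈ S, x < y) :
    ∃ (lam : Ordinal.{u₃}) (γ : Set.Iio lam → Γ), Order.IsSuccLimit lam ∧ StrictMono γ ∧
      (∀ ν, γ ν ∈ S) ∧ ∀ x ∈ S, ∃ ν, x ≤ γ ν := by
  -- `T` consists of the elements exceeding all their predecessors in some well-ordering of `S`. On
  -- `T` the two orders agree.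
  obtain ⟨T, hT, hwf⟩ : ∃ T : Set S, IsCofinal T ∧ WellFoundedLT T := by
    refine ⟨_, isCofinal_setOfPred_imp_lt (WellOrderingRel (α := S)), ⟨?_⟩⟩
    refine Subrelation.wf (r := fun x y : {a : S | ∀ b, WellOrderingRel b a → b < a} =>
      WellOrderingRel (x : S) (y : S)) (fun {x y} hxy => ?_)
      (InvImage.wf Subtype.val WellOrderingRel.isWellOrder.wf)
    rcases trichotomous_of WellOrderingRel (x : S) (y : S) with h | h | h
    · exact h
    · exact absurd h (ne_of_lt hxy)
    · exact absurd (x.2 _ h) (not_lt_of_gt hxy)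
  have : Nonempty S := hS.to_subtype
  have : NoMaxOrder S := ⟨fun x => by
    obtain ⟨y, hy, hxy⟩ := hmax x x.2
    exact ⟨⟨y, hy⟩, hxy⟩⟩
  have : Nonempty T := hT.nonempty.to_subtype
  have : NoMaxOrder T := ⟨fun x => by
    obtain ⟨y, hxy⟩ := exists_gt (x : S)
    obtain ⟨z, hz, hyz⟩ := hT y
    exact ⟨⟨z, hz⟩, hxy.trans_le hyz⟩⟩
  let e := Ordinal.enum (fun x y : T => x < y)
  refine ⟨Ordinal.type (fun x y : T => x < y), fun ν => (e ν : S), ?_, ?_, ?_, ?_⟩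
  · refine ⟨fun h => ?_, Ordinal.isSuccPrelimit_type_lt⟩
    exact Ordinal.type_ne_zero_of_nonempty (fun x y : T => x < y) (isMin_iff_eq_bot.1 h)
  · intro a b hab
    exact e.map_rel_iff.2 hab
  · exact fun ν => (e ν : S).2
  · intro x hx
    obtain ⟨y, hy, hxy⟩ := hT ⟨x, hx⟩
    refine ⟨e.symm ⟨y, hy⟩, ?_⟩
    change x ≤ ((e (e.symm ⟨y, hy⟩) : S) : Γ)
    rw [e.apply_symm_apply]
    exact hxy

/-! ### Existence of the approximating sequence -/

section Existence

variable {K : Type u₁} {L : Type u₂} {Γ : Type u₃} [Field K] [Field L] [Algebra K L]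
  [AddCommGroup Γ] [LinearOrder Γ] [IsOrderedAddMonoid Γ]

theorem exists_valPoly_X_sub_C_eq (v : AddValuation (RatFunc L) (WithTop Γ)) (b : L) :
    ∃ g : Γ, valPoly v (X - C b) = g :=
  exists_coe_eq v (by
    rw [Ne, map_eq_zero_iff _ (IsFractionRing.injective _ _)]
    exact X_sub_C_ne_zero b)

/-- The valuation of `L[X]` induced by `v`. -/
noncomputable abbrev polyValuation (v : AddValuation (RatFunc L) (WithTop Γ)) :
    AddValuation L[X] (WithTop Γ) :=
  v.comap (algebraMap L[X] (RatFunc L))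

theorem valPoly_eq (v : AddValuation (RatFunc L) (WithTop Γ)) (f : L[X]) :
    valPoly v f = polyValuation v f := rfl

theorem le_valPoly_X_sub_C (v : AddValuation (RatFunc L) (WithTop Γ)) {a b : L} {g : WithTop Γ}
    (ha : g ≤ valPoly v (X - C a)) (hb : g ≤ valConst v (a - b)) : g ≤ valPoly v (X - C b) := by
  have h := (polyValuation v).map_le_add ha hb
  rwa [C_sub, sub_add_sub_cancel] at h

theorem le_valConst_sub (v : AddValuation (RatFunc L) (WithTop Γ)) {a b : L} {g : WithTop Γ}
    (ha : g ≤ valPoly v (X - C a)) (hb : g ≤ valPoly v (X - C b)) : g ≤ valConst v (a - b) := by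
  have h := (polyValuation v).map_le_sub hb ha
  rwa [sub_sub_sub_cancel_left, ← C_sub] at h

/-- Every bound is attained by an element of least degree that is a best approximation of `X`
among its conjugates. -/
theorem exists_minimalPair_ge [Algebra.IsAlgebraic K L] (v : AddValuation (RatFunc L) (WithTop Γ))
    (b : L) : ∃ (a : L) (g : Γ), valPoly v (X - C b) ≤ g ∧ valPoly v (X - C a) = g ∧
      IsMinimalPair K v (valPair v a g) a g ∧
      ∀ σ : L ≃ₐ[K] L, valPoly v (X - C (σ a)) ≤ valPoly v (X - C a) := by
  -- Least degree is taken over all elements at least as close to `X` as `b`. Passing to the nearest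
  -- conjugate later keeps both the degree and the bound.
  obtain ⟨a₀, ha₀, hmin⟩ := exists_minimalFor_of_wellFoundedLT
    (fun a : L => valPoly v (X - C b) ≤ valPoly v (X - C a))
    (fun a => Module.finrank K K⟮a⟯) ⟨b, le_rfl⟩
  have hfin : (Set.range fun σ : L ≃ₐ[K] L => σ a₀).Finite := by
    refine ((minpoly K a₀).rootSet_finite L).subset ?_
    rintro _ ⟨σ, rfl⟩
    rw [mem_rootSet]
    refine ⟨minpoly.ne_zero (Algebra.IsIntegral.isIntegral a₀), ?_⟩
    rw [← minpoly.algEquiv_eq σ, minpoly.aeval]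
  obtain ⟨_, ⟨σ₀, rfl⟩, hmax⟩ := hfin.exists_maximalFor (fun a => valPoly v (X - C a)) _
    ⟨_, AlgEquiv.refl, rfl⟩
  have hle : ∀ σ : L ≃ₐ[K] L, valPoly v (X - C (σ a₀)) ≤ valPoly v (X - C (σ₀ a₀)) :=
    fun σ => (le_total _ _).elim id fun h => hmax ⟨σ, rfl⟩ h
  obtain ⟨g, hg⟩ := exists_valPoly_X_sub_C_eq v (σ₀ a₀)
  have hbg : valPoly v (X - C b) ≤ g := hg ▸ ha₀.trans (hle AlgEquiv.refl)
  refine ⟨σ₀ a₀, g, hbg, hg, ⟨fun _ => rfl, fun a' ha' => ?_⟩, fun σ => hle (σ₀.trans σ)⟩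
  have h1 := le_valPoly_X_sub_C v hg.ge ha'
  have h2 : Module.finrank K K⟮σ₀ a₀⟯ = Module.finrank K K⟮a₀⟯ := by
    rw [IntermediateField.adjoin.finrank (Algebra.IsIntegral.isIntegral _),
      IntermediateField.adjoin.finrank (Algebra.IsIntegral.isIntegral _), minpoly.algEquiv_eq]
  rw [h2]
  exact (le_total _ _).elim id fun h => hmin (hbg.trans h1) h

/-- A valuation algebraic extension admits a cofinal sequence of minimal pairs that are best
approximations of `X` among their conjugates. -/
theorem IsValuationAlgebraic.exists_isApproxSequence [IsAlgClosure K L]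
    {v : AddValuation (RatFunc L) (WithTop Γ)} (hv : IsValuationAlgebraic K v) :
    ∃ (lam : Ordinal.{u₃}) (γ : Set.Iio lam → Γ) (a : Set.Iio lam → L),
      IsApproxSequence K v lam γ a := by
  have : Algebra.IsAlgebraic K L := IsAlgClosure.isAlgebraic
  let S : Set Γ := {g | ∃ a : L, valPoly v (X - C a) = g ∧
      IsMinimalPair K v (valPair v a g) a g ∧
      ∀ σ : L ≃ₐ[K] L, valPoly v (X - C (σ a)) ≤ valPoly v (X - C a)}
  have hcof : ∀ b : L, ∃ g ∈ S, valPoly v (X - C b) ≤ g := fun b => by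
    obtain ⟨a, g, h1, h2⟩ := exists_minimalPair_ge (K := K) v b
    exact ⟨g, ⟨a, h2⟩, h1⟩
  obtain ⟨lam, γ, hlim, hmono, hmem, hcof'⟩ := exists_strictMono_cofinal (S := S)
    (by obtain ⟨g, hg, -⟩ := hcof 0; exact ⟨g, hg⟩) (by
      rintro x ⟨a, ha, -⟩
      obtain ⟨b, hb⟩ := hv.exists_lt a
      obtain ⟨g, hg, hbg⟩ := hcof b
      exact ⟨g, hg, WithTop.coe_lt_coe.1 (ha ▸ hb.trans_le hbg)⟩)
  choose a ha using hmem
  refine ⟨lam, γ, a, hlim, hmono, fun b => ?_, fun ν => (ha ν).1, fun ν => (ha ν).2.1,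
    fun ν => (ha ν).2.2⟩
  obtain ⟨g, hg, hbg⟩ := hcof b
  obtain ⟨ν, hν⟩ := hcof' g hg
  exact ⟨ν, hbg.trans (WithTop.coe_le_coe.2 hν)⟩

end Existence

section Expansion

theorem divByMonic_divByMonic {R : Type*} [Field R] (f : R[X]) {P Q : R[X]} (hP : P.Monic)
    (hQ : Q.Monic) : (f /ₘ P) /ₘ Q = f /ₘ (P * Q) := by
  refine ((div_modByMonic_unique ((f /ₘ P) /ₘ Q) (f %ₘ P + P * ((f /ₘ P) %ₘ Q)) (hP.mul hQ)
    ⟨?_, ?_⟩).1).symm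
  · have e1 := modByMonic_add_div f P
    have e2 := modByMonic_add_div (f /ₘ P) Q
    linear_combination e1 + P * e2
  · rw [degree_mul]
    refine (degree_add_le _ _).trans_lt (max_lt ?_ ?_)
    · refine (degree_modByMonic_lt _ hP).trans_le ?_
      rw [degree_eq_natDegree hP.ne_zero, degree_eq_natDegree hQ.ne_zero]
      exact_mod_cast Nat.le_add_right _ _
    · rw [degree_mul]
      exact WithBot.add_lt_add_left (by simpa using hP.ne_zero) (degree_modByMonic_lt _ hQ)

end Expansion

/-! ### One-sided estimates for `v_{a,γ}` -/

section Pair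

variable {L Γ : Type*} [Field L] [AddCommGroup Γ] [LinearOrder Γ] [IsOrderedAddMonoid Γ]

/-- The valuation of `L` induced by `v`. -/
noncomputable abbrev constValuation (v : AddValuation (RatFunc L) (WithTop Γ)) :
    AddValuation L (WithTop Γ) :=
  (polyValuation v).comap C

theorem valPoly_mul (v : AddValuation (RatFunc L) (WithTop Γ)) (f g : L[X]) :
    valPoly v (f * g) = valPoly v f + valPoly v g :=
  (polyValuation v).map_mul f g

theorem valConst_mul (v : AddValuation (RatFunc L) (WithTop Γ)) (x y : L) :
    valConst v (x * y) = valConst v x + valConst v y :=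
  (constValuation v).map_mul x y

theorem valConst_eq (v : AddValuation (RatFunc L) (WithTop Γ)) (x : L) :
    valConst v x = constValuation v x := rfl

variable {v : AddValuation (RatFunc L) (WithTop Γ)} {a : L} {γ : Γ}

/-- Coefficients beyond the degree have value `∞`, so the bound on `i` can be dropped. -/
theorem le_valPair_iff {m : WithTop Γ} {f : L[X]} :
    m ≤ valPair v a γ f ↔
      ∀ i, m ≤ constValuation v ((taylor a f).coeff i) + ((i • γ : Γ) : WithTop Γ) := by
  rw [valPair, Finset.le_inf_iff]
  refine ⟨fun h i => ?_, fun h i _ => h i⟩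
  by_cases hi : i ≤ f.natDegree
  · exact h i (Finset.mem_range.2 (Nat.lt_succ_of_le hi))
  · rw [coeff_eq_zero_of_natDegree_lt (by rw [natDegree_taylor]; omega),
      AddValuation.map_zero, top_add]
    exact le_top

theorem valPair_le (f : L[X]) (i : ℕ) : valPair v a γ f ≤
    constValuation v ((taylor a f).coeff i) + ((i • γ : Γ) : WithTop Γ) :=
  le_valPair_iff.1 le_rfl i

theorem valPair_le_eval (f : L[X]) : valPair v a γ f ≤ valConst v (f.eval a) := by
  have h := valPair_le (v := v) (a := a) (γ := γ) f 0
  rwa [taylor_coeff_zero, zero_nsmul, WithTop.coe_zero, add_zero] at h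

theorem le_valPair_sub {m : WithTop Γ} {f g : L[X]} (hf : m ≤ valPair v a γ f)
    (hg : m ≤ valPair v a γ g) : m ≤ valPair v a γ (f - g) := by
  rw [le_valPair_iff] at hf hg ⊢
  intro i
  rw [map_sub, coeff_sub]
  refine le_trans ?_ (add_le_add_left ((constValuation v).map_sub _ _) _)
  rcases min_choice (constValuation v ((taylor a f).coeff i))
    (constValuation v ((taylor a g).coeff i)) with h | h <;> rw [h]
  exacts [hf i, hg i]

/-- The ultrametric inequality for the convolution of Taylor coefficients suffices here. The
opposite estimate is needed only for linear factors. -/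
theorem add_valPair_le_mul (f g : L[X]) :
    valPair v a γ f + valPair v a γ g ≤ valPair v a γ (f * g) := by
  rw [le_valPair_iff]
  intro n
  rw [taylor_mul, coeff_mul]
  have htop : ((n • γ : Γ) : WithTop Γ) ≠ ⊤ := WithTop.coe_ne_top
  have hsum : ∀ p ∈ Finset.HasAntidiagonal.antidiagonal n, valPair v a γ f + valPair v a γ g +
      ((-(n • γ) : Γ) : WithTop Γ) ≤
      constValuation v ((taylor a f).coeff p.1 * (taylor a g).coeff p.2) := by
    rintro ⟨i, j⟩ hp
    rw [Finset.HasAntidiagonal.mem_antidiagonal] at hp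
    rw [← WithTop.add_le_add_iff_right htop, add_assoc, ← WithTop.coe_add, neg_add_cancel,
      WithTop.coe_zero, add_zero, AddValuation.map_mul, ← hp, add_nsmul, WithTop.coe_add,
      add_add_add_comm]
    exact add_le_add (valPair_le f i) (valPair_le g j)
  have h := (constValuation v).map_le_sum hsum
  rw [← WithTop.add_le_add_iff_right htop, add_assoc, ← WithTop.coe_add, neg_add_cancel,
    WithTop.coe_zero, add_zero] at h
  exact h

theorem valPair_C (c : L) : valPair v a γ (C c) = valConst v c := by
  simp [valPair]

theorem le_valPair_X_sub_C (b : L) :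
    min (valConst v (a - b)) (γ : WithTop Γ) ≤ valPair v a γ (X - C b) := by
  rw [le_valPair_iff]
  intro i
  rw [map_sub, taylor_X, taylor_C, add_sub_assoc, ← C_sub]
  match i with
  | 0 => simp [valConst_eq]
  | 1 => simp
  | i + 2 => simp [coeff_X]

/-- Multiplying by a linear factor raises `v_{a,γ}` by at most the value of the factor. -/
theorem valPair_X_sub_C_mul_le (ha : valPoly v (X - C a) = γ) (b : L) (q : L[X]) :
    valPair v a γ ((X - C b) * q) ≤ valPoly v (X - C b) + valPair v a γ q := by
  by_cases hq : q = 0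
  · simp [hq, valPair, valConst_eq]
  set u := constValuation v
  set p := taylor a q
  set e := a - b
  set M := valPair v a γ q
  have hb : min (u e) γ ≤ valPoly v (X - C b) := le_valPoly_X_sub_C v
    ((min_le_right _ _).trans ha.ge) (min_le_left _ _)
  suffices h : ∃ i, u ((taylor a ((X - C b) * q)).coeff i) + ((i • γ : Γ) : WithTop Γ) ≤
      min (u e) γ + M by
    obtain ⟨i, hi⟩ := h
    exact (valPair_le _ i).trans (hi.trans (add_le_add_left hb _))
  have htaylor : taylor a ((X - C b) * q) = (X + C e) * p := by
    rw [taylor_mul, map_sub, taylor_X, taylor_C, add_sub_assoc, ← C_sub]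
  have hc0 : (taylor a ((X - C b) * q)).coeff 0 = e * p.coeff 0 := by
    rw [htaylor]; simp [add_mul]
  have hcs : ∀ i, (taylor a ((X - C b) * q)).coeff (i + 1) = p.coeff i + e * p.coeff (i + 1) := by
    intro i; rw [htaylor]; simp [add_mul]
  have hMle : ∀ i, M ≤ u (p.coeff i) + ((i • γ : Γ) : WithTop Γ) := valPair_le q
  have hMtop : M ≠ ⊤ := by
    have h1 := hMle q.natDegree
    intro htop
    rw [htop, top_le_iff, WithTop.add_eq_top] at h1
    rcases h1 with h1 | h1
    · rw [AddValuation.top_iff, coeff_taylor_natDegree, leadingCoeff_eq_zero] at h1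
      exact hq h1
    · exact WithTop.coe_ne_top h1
  -- Such an index exists because the minimum `M` is finite while the coefficients eventually
  -- vanish.
  obtain ⟨i, hi, hmax⟩ : ∃ i, u (p.coeff i) + ((i • γ : Γ) : WithTop Γ) = M ∧
      M < u (p.coeff (i + 1)) + (((i + 1) • γ : Γ) : WithTop Γ) := by
    by_contra! hcon
    have hall : ∀ i, u (p.coeff i) + ((i • γ : Γ) : WithTop Γ) = M → ∀ k,
        u (p.coeff (i + k)) + (((i + k) • γ : Γ) : WithTop Γ) = M := by
      intro i hi k
      induction k with
      | zero => exact hi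
      | succ k ih => exact le_antisymm (hcon _ ih) (hMle _)
    obtain ⟨i, -, hi⟩ := Finset.exists_mem_eq_inf (Finset.range (q.natDegree + 1))
      ⟨0, by simp⟩ (fun i => valConst v ((taylor a q).coeff i) + ((i • γ : Γ) : WithTop Γ))
    have h1 := hall i hi.symm (q.natDegree + 1)
    rw [coeff_eq_zero_of_natDegree_lt (by rw [natDegree_taylor]; omega),
      AddValuation.map_zero, top_add] at h1
    exact hMtop h1.symm
  -- If `u e < γ`, then `e p_i` strictly dominates coefficient `i` of `(X + e) p`; otherwise `p_i`
  -- strictly dominates coefficient `i + 1`.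
  rcases lt_or_ge (u e) (γ : WithTop Γ) with hlt | hge
  · rw [min_eq_left hlt.le]
    refine ⟨i, ?_⟩
    rw [← hi, ← add_assoc, ← AddValuation.map_mul]
    cases i with
    | zero => rw [hc0]
    | succ k =>
      rw [hcs, AddValuation.map_add_eq_of_lt_right]
      have h1 := hi.le.trans (hMle k)
      rw [succ_nsmul', WithTop.coe_add, ← add_assoc,
        WithTop.add_le_add_iff_right WithTop.coe_ne_top] at h1
      refine lt_of_lt_of_le ?_ h1
      rw [AddValuation.map_mul, add_comm]
      refine WithTop.add_lt_add_left ?_ hlt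
      intro htop
      rw [htop, top_add] at hi
      exact hMtop hi.symm
  · rw [min_eq_right hge]
    refine ⟨i + 1, ?_⟩
    rw [hcs, AddValuation.map_add_eq_of_lt_left, succ_nsmul', WithTop.coe_add, ← hi]
    · exact (add_left_comm _ _ _).le
    · rw [← hi, succ_nsmul', WithTop.coe_add, ← add_assoc,
        WithTop.add_lt_add_iff_right WithTop.coe_ne_top] at hmax
      refine hmax.trans_le ?_
      rw [AddValuation.map_mul, add_comm]
      exact add_le_add_left hge _

theorem valPair_prod_mul_le (ha : valPoly v (X - C a) = γ) (s : Multiset L) (q : L[X]) :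
    valPair v a γ ((s.map fun b => X - C b).prod * q) ≤
      valPoly v (s.map fun b => X - C b).prod + valPair v a γ q := by
  induction s using Multiset.induction with
  | empty => simp [valPoly]
  | cons b s ih =>
    rw [Multiset.map_cons, Multiset.prod_cons, mul_assoc]
    refine (valPair_X_sub_C_mul_le ha b _).trans ?_
    rw [valPoly_mul, add_assoc]
    exact add_le_add_right ih _

/-- If `b` is no closer to `X` than `a`, then `v(X - b) ≤ min (v(a - b)) γ`. Supermultiplicativity
combines the factors. -/
theorem valPoly_le_valPair_prod (s : Multiset L) (c : L) (ha : valPoly v (X - C a) = γ)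
    (hs : ∀ b ∈ s, valPoly v (X - C b) ≤ γ) :
    valPoly v (C c * (s.map fun b => X - C b).prod) ≤
      valPair v a γ (C c * (s.map fun b => X - C b).prod) := by
  induction s using Multiset.induction with
  | empty => simp [valPair_C, valConst]
  | cons b s ih =>
    rw [Multiset.map_cons, Multiset.prod_cons, mul_left_comm, valPoly_mul]
    refine le_trans (add_le_add ?_ (ih fun x hx => hs x (Multiset.mem_cons_of_mem hx)))
      (add_valPair_le_mul _ _)
    have hb := hs b (Multiset.mem_cons_self b s)
    exact (le_min (le_valConst_sub v (hb.trans ha.ge) le_rfl) hb).trans (le_valPair_X_sub_C b)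

/-- If `b` is strictly farther from `X` than `a`, then `v(X - b) = v(a - b)`, so `X` may be replaced
by `a` in each factor. -/
theorem valPoly_prod_eq_eval (s : Multiset L) (c : L) (ha : valPoly v (X - C a) = γ)
    (hs : ∀ b ∈ s, valPoly v (X - C b) < γ) :
    valPoly v (C c * (s.map fun b => X - C b).prod) =
      valConst v ((C c * (s.map fun b => X - C b).prod).eval a) := by
  induction s using Multiset.induction with
  | empty => simp [valConst]
  | cons b s ih =>
    rw [Multiset.map_cons, Multiset.prod_cons, mul_left_comm, eval_mul, valPoly_mul, valConst_mul,
      ih fun x hx => hs x (Multiset.mem_cons_of_mem hx)]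
    congr 1
    have hb : polyValuation v (X - C b) < polyValuation v (X - C a) :=
      (hs b (Multiset.mem_cons_self b s)).trans_eq ha.symm
    rw [valPoly_eq, ← AddValuation.map_sub_eq_of_lt_left _ hb, sub_sub_sub_cancel_left, ← C_sub,
      eval_sub, eval_X, eval_C]
    rfl

end Pair

/-! ### Minimal pairs, key polynomials and truncation -/

section MinimalPair

variable {K L Γ : Type*} [Field K] [Field L] [Algebra K L]
  [AddCommGroup Γ] [LinearOrder Γ] [IsOrderedAddMonoid Γ]
  {v : AddValuation (RatFunc L) (WithTop Γ)} {a : L} {γ : Γ}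

theorem map_eq_C_mul_prod_aroots [IsAlgClosed L] (f : K[X]) :
    f.map (algebraMap K L) = C (algebraMap K L f.leadingCoeff) *
      ((f.aroots L).map fun b => X - C b).prod := by
  have h := (IsAlgClosed.splits (f.map (algebraMap K L))).eq_prod_roots
  rwa [leadingCoeff_map] at h

theorem val_le_valPair [IsAlgClosed L] (ha : valPoly v (X - C a) = γ) {f : K[X]}
    (hf : ∀ b ∈ f.aroots L, valPoly v (X - C b) ≤ γ) :
    val v f ≤ valPair v a γ (f.map (algebraMap K L)) := by
  rw [val, map_eq_C_mul_prod_aroots]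
  exact valPoly_le_valPair_prod _ _ ha hf

theorem val_eq_valConst_aeval [IsAlgClosed L] (ha : valPoly v (X - C a) = γ) {f : K[X]}
    (hf : ∀ b ∈ f.aroots L, valPoly v (X - C b) < γ) :
    val v f = valConst v (aeval a f) := by
  rw [val, aeval_def, ← eval_map, map_eq_C_mul_prod_aroots]
  exact valPoly_prod_eq_eval _ _ ha hf

theorem valPair_mul_le_of_monic [IsAlgClosed L] (ha : valPoly v (X - C a) = γ) {Q : K[X]}
    (hQ : Q.Monic) (q : L[X]) :
    valPair v a γ (Q.map (algebraMap K L) * q) ≤ val v Q + valPair v a γ q := by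
  have h := map_eq_C_mul_prod_aroots (L := L) Q
  rw [hQ.leadingCoeff, map_one, C_1, one_mul] at h
  rw [val, h]
  exact valPair_prod_mul_le ha _ _

theorem delta_lt_coe {f : K[X]} (hf : ∀ b ∈ f.aroots L, valPoly v (X - C b) < γ) :
    delta v f < ((γ : WithTop Γ) : WithBot (WithTop Γ)) := by
  rw [delta]
  generalize f.aroots L = s at hf
  induction s using Multiset.induction with
  | empty => exact WithBot.bot_lt_coe _
  | cons b s ih =>
    rw [Multiset.map_cons, Multiset.sup_cons]
    exact max_lt (WithBot.coe_lt_coe.2 (hf b (Multiset.mem_cons_self b s)))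
      (ih fun x hx => hf x (Multiset.mem_cons_of_mem hx))

variable [Normal K L]

/-- Roots of polynomials of degree less than that of `a` are farther from `X` than `a`. -/
theorem valPoly_lt_of_mem_aroots (ha : valPoly v (X - C a) = γ)
    (hmin : IsMinimalPair K v (valPair v a γ) a γ) {f : K[X]}
    (hf : f.degree < (minpoly K a).degree) {b : L} (hb : b ∈ f.aroots L) :
    valPoly v (X - C b) < γ := by
  by_contra! hle
  obtain ⟨hf0, hfb⟩ := mem_aroots.1 hb
  have h1 := hmin.minimal b (le_valConst_sub v ha.ge hle)
  rw [IntermediateField.adjoin.finrank (Algebra.IsIntegral.isIntegral _),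
    IntermediateField.adjoin.finrank (Algebra.IsIntegral.isIntegral _)] at h1
  have h2 := natDegree_le_of_dvd (minpoly.dvd K b hfb) hf0
  exact absurd (natDegree_lt_natDegree hf0 hf) (not_lt.2 (h1.trans h2))

/-- By normality the roots are exactly the conjugates of `a`, among which `a` is nearest to `X`. -/
theorem delta_minpoly (ha : valPoly v (X - C a) = γ)
    (hconj : ∀ σ : L ≃ₐ[K] L, valPoly v (X - C (σ a)) ≤ valPoly v (X - C a)) :
    delta v (minpoly K a) = ((γ : WithTop Γ) : WithBot (WithTop Γ)) := by
  have hint := Algebra.IsIntegral.isIntegral (R := K) a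
  apply le_antisymm
  · refine Multiset.sup_le.2 fun x hx => ?_
    obtain ⟨b, hb, rfl⟩ := Multiset.mem_map.1 hx
    obtain ⟨σ, rfl⟩ := isConjRoot_iff_exists_algEquiv.1
      ((isConjRoot_iff_mem_minpoly_aroots hint).2 hb).symm
    exact WithBot.coe_le_coe.2 ((hconj σ).trans_eq ha)
  · refine Multiset.le_sup (Multiset.mem_map.2 ⟨a, ?_, by rw [ha]⟩)
    exact mem_aroots.2 ⟨minpoly.ne_zero hint, minpoly.aeval K a⟩

theorem isKeyPolynomial_minpoly (ha : valPoly v (X - C a) = γ)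
    (hmin : IsMinimalPair K v (valPair v a γ) a γ)
    (hconj : ∀ σ : L ≃ₐ[K] L, valPoly v (X - C (σ a)) ≤ valPoly v (X - C a)) :
    IsKeyPolynomial v (minpoly K a) where
  monic := minpoly.monic (Algebra.IsIntegral.isIntegral a)
  natDegree_pos := minpoly.natDegree_pos (Algebra.IsIntegral.isIntegral a)
  delta_lt f _ hf := by
    rw [delta_minpoly ha hconj]
    exact delta_lt_coe fun b hb => valPoly_lt_of_mem_aroots ha hmin hf hb

/-- The polynomial and its remainder agree at `a`, and the remainder has the value of its evaluation
there because all its roots are farther from `X` than `a`. -/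
theorem valPair_le_val_modByMonic [IsAlgClosed L] (ha : valPoly v (X - C a) = γ)
    (hmin : IsMinimalPair K v (valPair v a γ) a γ) (f : K[X]) :
    valPair v a γ (f.map (algebraMap K L)) ≤ val v (f %ₘ minpoly K a) := by
  have hm := minpoly.monic (Algebra.IsIntegral.isIntegral (R := K) a)
  rw [val_eq_valConst_aeval ha fun b hb =>
    valPoly_lt_of_mem_aroots ha hmin (degree_modByMonic_lt f hm) hb,
    aeval_modByMonic_eq_self_of_root (minpoly.aeval K a), aeval_def, ← eval_map]
  exact valPair_le_eval _

/-- Subtracting the remainder does not lower `v_{a,γ}`; what is left is a multiple of the minimal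
polynomial, whose linear factors are then stripped off. -/
theorem valPair_le_divByMonic [IsAlgClosed L] (ha : valPoly v (X - C a) = γ)
    (hmin : IsMinimalPair K v (valPair v a γ) a γ) (f : K[X]) :
    valPair v a γ (f.map (algebraMap K L)) ≤
      val v (minpoly K a) + valPair v a γ ((f /ₘ minpoly K a).map (algebraMap K L)) := by
  have hm := minpoly.monic (Algebra.IsIntegral.isIntegral (R := K) a)
  refine le_trans ?_ (valPair_mul_le_of_monic ha hm _)
  have h : minpoly K a * (f /ₘ minpoly K a) = f - f %ₘ minpoly K a :=
    (sub_eq_of_eq_add' (modByMonic_add_div f (minpoly K a)).symm).symm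
  rw [← Polynomial.map_mul, h, Polynomial.map_sub]
  refine le_valPair_sub le_rfl ((valPair_le_val_modByMonic ha hmin f).trans ?_)
  exact val_le_valPair ha fun b hb =>
    (valPoly_lt_of_mem_aroots ha hmin (degree_modByMonic_lt f hm) hb).le

theorem valPair_le_divByMonic_pow [IsAlgClosed L] (ha : valPoly v (X - C a) = γ)
    (hmin : IsMinimalPair K v (valPair v a γ) a γ) (f : K[X]) (i : ℕ) :
    valPair v a γ (f.map (algebraMap K L)) ≤
      valPair v a γ ((f /ₘ minpoly K a ^ i).map (algebraMap K L)) + i • val v (minpoly K a) := by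
  have hm := minpoly.monic (Algebra.IsIntegral.isIntegral (R := K) a)
  induction i with
  | zero => simp
  | succ i ih =>
    refine ih.trans ?_
    rw [pow_succ, ← divByMonic_divByMonic _ (hm.pow i) hm, succ_nsmul', ← add_assoc,
      add_comm (valPair v a γ _) (val v _)]
    exact add_le_add_left (valPair_le_divByMonic ha hmin _) _

/-- If all roots of `f` are at most as close to `X` as `a`, then `f` has the same value under `v`
as under the truncation at the minimal polynomial of `a`. -/
theorem val_eq_truncVal [IsAlgClosed L] (ha : valPoly v (X - C a) = γ)
    (hmin : IsMinimalPair K v (valPair v a γ) a γ) {f : K[X]}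
    (hf : ∀ b ∈ f.aroots L, valPoly v (X - C b) ≤ γ) :
    val v f = truncVal v (minpoly K a) f := by
  have hint := Algebra.IsIntegral.isIntegral (R := K) a
  apply le_antisymm
  · rw [truncVal, Finset.le_inf_iff]
    intro i _
    exact ((val_le_valPair ha hf).trans (valPair_le_divByMonic_pow ha hmin f i)).trans
      (add_le_add_left (valPair_le_val_modByMonic ha hmin _) _)
  -- This direction is the ultrametric inequality for the expansion and needs nothing about the
  -- roots of `f`.
  · have hsum := sum_expCoeff (minpoly.monic hint) (minpoly.natDegree_pos hint) f
    have hle : truncVal v (minpoly K a) f ≤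
        (polyValuation v).comap (mapRingHom (algebraMap K L))
          (∑ i ∈ Finset.range (f.natDegree + 1), expCoeff (minpoly K a) f i * minpoly K a ^ i) := by
      refine AddValuation.map_le_sum _ fun i hi => (Finset.inf_le hi).trans_eq ?_
      rw [AddValuation.map_mul, AddValuation.map_pow]
      rfl
    rwa [← hsum] at hle

end MinimalPair

/-! ### The complete sequence -/

section ApproxSequence

variable {K L Γ : Type*} [Field K] [Field L] [Algebra K L]
  [AddCommGroup Γ] [LinearOrder Γ] [IsOrderedAddMonoid Γ]
  {v : AddValuation (RatFunc L) (WithTop Γ)} {lam : Ordinal} {γ : Set.Iio lam → Γ}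
  {a : Set.Iio lam → L}

theorem IsApproxSequence.exists_forall_le (h : IsApproxSequence K v lam γ a) (s : Multiset L) :
    ∃ ν, ∀ b ∈ s, valPoly v (X - C b) ≤ γ ν := by
  induction s using Multiset.induction with
  | empty =>
    obtain ⟨ν, -⟩ := h.cofinal 0
    exact ⟨ν, by simp⟩
  | cons b s ih =>
    obtain ⟨ν, hν⟩ := ih
    obtain ⟨μ, hμ⟩ := h.cofinal b
    refine ⟨max ν μ, fun x hx => ?_⟩
    rcases Multiset.mem_cons.1 hx with rfl | hx
    · exact hμ.trans (WithTop.coe_le_coe.2 (h.strictMono.monotone (le_max_right _ _)))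
    · exact (hν x hx).trans (WithTop.coe_le_coe.2 (h.strictMono.monotone (le_max_left _ _)))

variable [IsAlgClosure K L]

theorem IsApproxSequence.delta_minpoly (h : IsApproxSequence K v lam γ a) (ν : Set.Iio lam) :
    delta v (minpoly K (a ν)) = ((γ ν : WithTop Γ) : WithBot (WithTop Γ)) :=
  have : Algebra.IsAlgebraic K L := IsAlgClosure.isAlgebraic
  have : Normal K L := IsAlgClosure.normal K L
  KeyPol.delta_minpoly (h.val_eq ν) (h.conj_le ν)

theorem IsApproxSequence.injective_delta (h : IsApproxSequence K v lam γ a) :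
    Function.Injective fun ν => delta v (minpoly K (a ν)) := by
  intro ν μ hνμ
  simp only [h.delta_minpoly, WithBot.coe_inj, WithTop.coe_inj] at hνμ
  exact h.strictMono.injective hνμ

theorem IsApproxSequence.isCompleteSequence (h : IsApproxSequence K v lam γ a) :
    IsCompleteSequence v (Set.range fun ν => minpoly K (a ν)) := by
  have : Algebra.IsAlgebraic K L := IsAlgClosure.isAlgebraic
  have : Normal K L := IsAlgClosure.normal K L
  have : IsAlgClosed L := IsAlgClosure.isAlgClosed K
  refine ⟨?_, ?_, ?_, ?_⟩
  · rintro _ ⟨ν, rfl⟩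
    exact isKeyPolynomial_minpoly (h.val_eq ν) (h.minimalPair ν) (h.conj_le ν)
  · rintro _ ⟨ν, rfl⟩ _ ⟨μ, rfl⟩ hne heq
    exact hne (congrArg (fun ν => minpoly K (a ν)) (h.injective_delta heq))
  -- As `δ(Q_ν) = γ_ν` is strictly increasing, the order by `δ` is transported from the ordinal
  -- `lam`.
  · let e : Set.Iio lam ≃ Set.range fun ν => minpoly K (a ν) :=
      Equiv.ofInjective _ fun ν μ hνμ => h.injective_delta (congrArg (delta v) hνμ)
    let r : ((· < ·) : Set.Iio lam → Set.Iio lam → Prop) ≃r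
        fun Q Q' : Set.range (fun ν => minpoly K (a ν)) =>
          delta v (Q : K[X]) < delta v (Q' : K[X]) :=
      ⟨e, fun {ν μ} => by
        change delta v (minpoly K (a ν)) < delta v (minpoly K (a μ)) ↔ _
        rw [h.delta_minpoly, h.delta_minpoly, WithBot.coe_lt_coe, WithTop.coe_lt_coe,
          h.strictMono.lt_iff_lt]⟩
    exact r.symm.toRelEmbedding.isWellOrder
  · intro f
    obtain ⟨ν, hν⟩ := h.exists_forall_le (f.aroots L)
    exact ⟨_, ⟨ν, rfl⟩, val_eq_truncVal (h.val_eq ν) (h.minimalPair ν) hν⟩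

end ApproxSequence

end KeyPol

theorem theorem7p4 {K : Type u₁} {L : Type u₂} {Γ : Type u₃} [Field K] [Field L] [Algebra K L]
    [IsAlgClosure K L] [AddCommGroup Γ] [LinearOrder Γ] [IsOrderedAddMonoid Γ]
    (v : AddValuation (RatFunc L) (WithTop Γ)) (hv : KeyPol.IsValuationAlgebraic K v) :
    (∃ (lam : Ordinal.{u₃}) (γ : Set.Iio lam → Γ) (a : Set.Iio lam → L),
      KeyPol.IsApproxSequence K v lam γ a) ∧
    ∀ (lam : Ordinal.{u₄}) (γ : Set.Iio lam → Γ) (a : Set.Iio lam → L),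
      KeyPol.IsApproxSequence K v lam γ a →
        Function.Injective (fun ν => KeyPol.delta v (minpoly K (a ν))) ∧
        KeyPol.IsCompleteSequence v (Set.range fun ν => minpoly K (a ν)) :=
  ⟨hv.exists_isApproxSequence, fun _ _ _ h => ⟨h.injective_delta, h.isCompleteSequence⟩⟩
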